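/- Let $G$ be a group acting on the right on a set $X$, and let $\mu\colon G\to[0,1]$ be a probability measure on $G$ (so $\sum_{g\in G}\mu(g)=1$). Suppose that $\mu$ is non-degenerate, i.e. that its support generates $G$ as a semigroup. Consider the random walk on $X$ driven by $\mu$: its one-step transition probabilities, from $y$ to $x$, are $p_1(x,y)=\sum_{g\in G,\;x=yg}\mu(g)$, and its $n$-step transition probabilities are given by $p_0(x,y)=\mathbb 1_{x=y}$ and $p_n(x,y)=\sum_{z\in X}p_{n-1}(x,z)\,p_1(z,y)$. Suppose that this walk is reversible, i.e. there is a function $s\colon X\to(0,\infty)$ with $s(x)p_1(x,y)=s(y)p_1(y,x)$ for all $x,y\in X$ (for example, this holds with $s\equiv1$ if $\mu(g)=\mu(g^{-1})$ for all $g\in G$), and that it is recurrent, i.e. $\sum_{n\ge0}p_n(x,x)=\infty$ for every $x\in X$. Then $X$ is extensively amenable: denoting by $\mathfrak P_f(X)$ the set of finite subsets of $X$, there exists a mean $m$ on $\mathfrak P_f(X)$ (a finitely additive map from the set of subsets of $\mathfrak P_f(X)$ to $[0,1]$ with $m(\mathfrak P_f(X))=1$) that is $G$-invariant, i.e. $m(\{Eg: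 E\in\mathcal A\})=m(\mathcal A)$ for all $g\in G$ and $\mathcal A\subseteq\mathfrak P_f(X)$, and satisfies $m(\{E\in\mathfrak P_f(X): x\in E\})=1$ for every $x\in X$. -/

import Mathlib

open scoped ENNReal

/-- A mean on `Y`: a finitely additive map from the subsets of `Y` to `[0,1]` of total mass `1`. -/
structure Mean (Y : Type*) where
  toFun : Set Y → ℝ
  nonneg : ∀ A, 0 ≤ toFun A
  le_one : ∀ A, toFun A ≤ 1
  map_univ : toFun Set.univ = 1
  map_union : ∀ A B, Disjoint A B → toFun (A ∪ B) = toFun A + toFun B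

/-- The translate `E g = {x g : x ∈ E}` of a finite subset `E` of a right `G`-set `X`.
Right actions of `G` are actions of `Gᵐᵒᵖ`, so `x g` is `MulOpposite.op g • x`. -/
def translateFinset {G X : Type*} [Group G] [MulAction Gᵐᵒᵖ X] (E : Finset X) (g : G) : Finset X :=
  E.map (MulAction.toPerm (MulOpposite.op g) : Equiv.Perm X).toEmbedding

/-- The right `G`-set `X` is extensively amenable: there is a `G`-invariant mean on the set of
finite subsets of `X` giving weight `1` to `{E | x ∈ E}` for every `x : X`. -/
def IsExtensivelyAmenable (G X : Type*) [Group G] [MulAction Gᵐᵒᵖ X] : Prop :=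
  ∃ m : Mean (Finset X),
    (∀ (g : G) (A : Set (Finset X)), m.toFun ((fun E => translateFinset E g) '' A) = m.toFun A) ∧
      ∀ x : X, m.toFun {E : Finset X | x ∈ E} = 1

/-- A probability measure on a group is non-degenerate if its support generates the group as a
semigroup. -/
def IsNondegenerate {G : Type*} [Group G] (μ : PMF G) : Prop :=
  Subsemigroup.closure μ.support = ⊤

/-- The one-step transition probabilities on the right `G`-set `X` of the random walk driven by `μ`:
`drivenStep μ x y` is the probability, that is the sum of `μ g` over the `g` with `x = y g`,
of moving to `x` from `y`. -/
noncomputable def drivenStep {G X : Type*} [Group G] [MulAction Gᵐᵒᵖ X] (μ : PMF G) (x y : X) :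
    ℝ≥0∞ :=
  ∑' g : {g : G // x = MulOpposite.op g • y}, μ g

open Classical in
/-- The `n`-step transition probabilities of the random walk with one-step transition
probabilities `p`. -/
noncomputable def stepProb {X : Type*} (p : X → X → ℝ≥0∞) : ℕ → X → X → ℝ≥0∞
  | 0 => fun x y => if x = y then 1 else 0
  | n + 1 => fun x y => ∑' z : X, stepProb p n x z * p z y

/-- The random walk `p` is reversible: there is `s : X → (0, ∞)` with
`s x * p x y = s y * p y x`. -/
def IsReversibleWalk {X : Type*} (p : X → X → ℝ≥0∞) : Prop :=
  ∃ s : X → NNReal, (∀ x, 0 < s x) ∧ ∀ x y, (s x : ℝ≥0∞) * p x y = (s y : ℝ≥0∞) * p y x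

/-- The random walk `p` is recurrent (at every point): the expected number of returns to `x` of
the walk started at `x` is infinite. -/
def IsRecurrentWalk {X : Type*} (p : X → X → ℝ≥0∞) : Prop :=
  ∀ x, ∑' n : ℕ, stepProb p n x x = ∞

/-! By reversibility and since the `p x y` sum to `1` over `y`, the function `s` is harmonic.
Recurrence then makes it constant on orbits (`IsRecurrentWalk.le_of_harmonic`), so the walk is
symmetric (`drivenStep_comm`). For a symmetric recurrent walk, truncated Green functions, normalised
and clamped, give finitely supported `a : X → [0,1]` equal to `1` on a given finite set, with
arbitrarily small Dirichlet energy (`IsRecurrentWalk.exists_cutoff`). Such an `a` defines a random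
finite set containing each `x` independently with probability `sin (π / 2 * a x) ^ 2`. Square roots
of these probabilities form unit vectors whose inner products are products of cosines, so the law
varies little when `a` varies little in `ℓ²` (`sq_bernoulliMass_sub_le`). For `g` in the support of
`μ`, the energy controls the `ℓ²` distance from `a` to its translate. An ultrafilter limit of these
laws is the invariant mean. -/

section MarkovChain

/-! ### Harmonic functions of recurrent walks. -/

variable {X : Type*} {p : X → X → ℝ≥0∞}

lemma tsum_mul_stepProb_zero (f : X → ℝ≥0∞) (x : X) : ∑' y, f y * stepProb p 0 y x = f x := by
  rw [tsum_eq_single x]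
  · simp [stepProb]
  · intro y hy
    simp [stepProb, hy]

lemma tsum_mul_stepProb_succ (f : X → ℝ≥0∞) (n : ℕ) (x : X) :
    ∑' y, f y * stepProb p (n + 1) y x = ∑' z, (∑' y, f y * stepProb p n y z) * p z x := by
  simp only [stepProb, ← ENNReal.tsum_mul_left, ← ENNReal.tsum_mul_right]
  rw [ENNReal.tsum_comm]
  simp only [mul_assoc]

/-- For a recurrent walk, finite superharmonic functions are harmonic. -/
lemma IsRecurrentWalk.harmonic_of_superharmonic (hrec : IsRecurrentWalk p) {h : X → ℝ≥0∞}
    (hfin : ∀ x, h x ≠ ∞) (hsup : ∀ x, ∑' y, h y * p y x ≤ h x) (x : X) :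
    ∑' y, h y * p y x = h x := by
  set φ : X → ℝ≥0∞ := fun x => h x - ∑' y, h y * p y x with hφ
  -- The potential of the defect `φ` telescopes and stays below `h`; its diagonal term is `φ x`
  -- times the expected number of returns, which forces `φ x = 0`.
  have key : ∀ N x, ∑ n ∈ Finset.range N, ∑' y, φ y * stepProb p n y x ≤ h x := by
    intro N
    induction N with
    | zero => simp
    | succ N ih =>
      intro x
      rw [Finset.sum_range_succ', tsum_mul_stepProb_zero]
      simp only [tsum_mul_stepProb_succ]
      rw [← Summable.tsum_finsetSum (fun _ _ => ENNReal.summable)]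
      simp only [← Finset.sum_mul]
      calc _ ≤ ∑' z, h z * p z x + φ x := by
            gcongr with z
            exact ih z
        _ = h x := by rw [hφ]; exact add_tsub_cancel_of_le (hsup x)
  have hle : φ x * ∑' n, stepProb p n x x ≤ h x := by
    rw [← ENNReal.tsum_mul_left, ENNReal.tsum_eq_iSup_nat]
    refine iSup_le fun N => le_trans ?_ (key N x)
    gcongr with n
    exact ENNReal.le_tsum (f := fun y => φ y * stepProb p n y x) x
  have h0 : φ x = 0 := by
    by_contra h0
    rw [hrec x, ENNReal.mul_top h0] at hle
    exact hfin x (top_le_iff.1 hle)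
  exact le_antisymm (hsup x) (tsub_eq_zero_iff_le.1 h0)

/-- A positive harmonic function of a recurrent walk does not decrease along its edges. -/
lemma IsRecurrentWalk.le_of_harmonic (hrec : IsRecurrentWalk p)
    (hcol : ∀ x, ∑' y, p y x = 1) {s : X → ℝ≥0∞} (hfin : ∀ x, s x ≠ ∞)
    (hs : ∀ x, ∑' y, s y * p y x = s x) {x y : X} (hxy : p y x ≠ 0) : s x ≤ s y := by
  -- Truncating at `s x` gives a superharmonic, hence harmonic, function that attains its maximum at
  -- `x`. An average equal to the maximum leaves no smaller value at any `y` with `p y x ≠ 0`.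
  have hharm := hrec.harmonic_of_superharmonic (h := fun y => min (s y) (s x))
    (fun y => ((min_le_left _ _).trans_lt (hfin y).lt_top).ne) (fun z => le_min
      ((ENNReal.tsum_le_tsum fun y => by gcongr; exact min_le_left _ _).trans (hs z).le)
      ((ENNReal.tsum_le_tsum fun y => mul_le_mul_left (min_le_right _ _) _).trans
        (by rw [ENNReal.tsum_mul_left, hcol, mul_one]))) x
  by_contra! hlt
  have hpfin : p y x ≠ ∞ := by
    refine ne_top_of_le_ne_top ENNReal.one_ne_top ?_
    rw [← hcol x]
    exact ENNReal.le_tsum (f := fun y => p y x) y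
  have : ∑' y, min (s y) (s x) * p y x < ∑' y, s x * p y x := by
    refine ENNReal.tsum_lt_tsum (i := y) ?_ (fun y => mul_le_mul_left (min_le_right _ _) _) ?_
    · rw [hharm]
      simpa using hfin x
    · rw [min_eq_left hlt.le]
      exact ENNReal.mul_lt_mul_left hxy hpfin hlt
  rw [hharm, ENNReal.tsum_mul_left, hcol] at this
  simp at this

/-! ### Dirichlet energy, Green functions and cutoffs. -/

/-- The Dirichlet energy of a function. -/
noncomputable def dirichletEnergy (p : X → X → ℝ≥0∞) (a : X → ℝ) : ℝ≥0∞ :=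
  ∑' x, ∑' y, p x y * ENNReal.ofReal ((a x - a y) ^ 2)

lemma dirichletEnergy_le_mul {a b : X → ℝ} {C : ℝ}
    (h : ∀ x y, (b x - b y) ^ 2 ≤ C * (a x - a y) ^ 2) :
    dirichletEnergy p b ≤ ENNReal.ofReal C * dirichletEnergy p a := by
  simp only [dirichletEnergy, ← ENNReal.tsum_mul_left]
  refine ENNReal.tsum_le_tsum fun x => ENNReal.tsum_le_tsum fun y => ?_
  rw [mul_left_comm, ← ENNReal.ofReal_mul' (sq_nonneg _)]
  gcongr
  exact h x y

lemma sq_max_sub_max_le (a b c d : ℝ) :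
    (max a b - max c d) ^ 2 ≤ (a - c) ^ 2 + (b - d) ^ 2 := by
  have h := abs_max_sub_max_le_max a b c d
  rw [← sq_abs]
  rcases le_total |a - c| |b - d| with h' | h'
  · rw [max_eq_right h'] at h
    nlinarith [abs_nonneg (max a b - max c d), sq_abs (b - d), sq_nonneg (a - c)]
  · rw [max_eq_left h'] at h
    nlinarith [abs_nonneg (max a b - max c d), sq_abs (a - c), sq_nonneg (b - d)]

lemma dirichletEnergy_max_le (a b : X → ℝ) :
    dirichletEnergy p (fun x => max (a x) (b x)) ≤ dirichletEnergy p a + dirichletEnergy p b := by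
  simp only [dirichletEnergy, ← ENNReal.tsum_add, ← mul_add]
  refine ENNReal.tsum_le_tsum fun x => ENNReal.tsum_le_tsum fun y => ?_
  rw [← ENNReal.ofReal_add (sq_nonneg _) (sq_nonneg _)]
  gcongr
  exact sq_max_sub_max_le _ _ _ _

/-- Expanding the square shows that the energy is `2⟨u, (1 - P)u⟩`; the additive form avoids
truncated subtraction. -/
lemma dirichletEnergy_add_two_mul (hsymm : ∀ x y, p x y = p y x)
    (hrow : ∀ x, ∑' y, p x y = 1) {u : X → ℝ≥0∞} (hu : ∀ x, u x ≠ ∞) :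
    dirichletEnergy p (fun x => (u x).toReal) + 2 * ∑' x, u x * ∑' y, u y * p y x =
      2 * ∑' x, u x ^ 2 := by
  have hpt (x y : X) : ENNReal.ofReal (((u x).toReal - (u y).toReal) ^ 2) + 2 * (u x * u y) =
      u x ^ 2 + u y ^ 2 := by
    lift u to X → NNReal using hu
    simp only [ENNReal.coe_toReal]
    rw [← ENNReal.ofReal_coe_nnreal (p := u x), ← ENNReal.ofReal_coe_nnreal (p := u y),
      show (2 : ℝ≥0∞) = ENNReal.ofReal 2 by simp, ← ENNReal.ofReal_mul (by positivity),
      ← ENNReal.ofReal_mul (by positivity), ← ENNReal.ofReal_pow (by positivity),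
      ← ENNReal.ofReal_pow (by positivity), ← ENNReal.ofReal_add (by positivity) (by positivity),
      ← ENNReal.ofReal_add (by positivity) (by positivity)]
    congr 1
    ring
  have h1 : ∑' x, ∑' y, p x y * (u x ^ 2 + u y ^ 2) = 2 * ∑' x, u x ^ 2 := by
    simp only [mul_add, ENNReal.tsum_add]
    rw [ENNReal.tsum_comm (f := fun x y => p x y * u y ^ 2)]
    simp only [ENNReal.tsum_mul_right, hsymm _ _, hrow, one_mul]
    rw [two_mul]
  rw [← h1]
  simp only [dirichletEnergy, ← ENNReal.tsum_mul_left, ← ENNReal.tsum_add]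
  refine tsum_congr fun x => tsum_congr fun y => ?_
  rw [← hpt x y, hsymm y x]
  ring

lemma tsum_stepProb (hrow : ∀ x, ∑' y, p x y = 1) (n : ℕ) (x : X) :
    ∑' y, stepProb p n x y = 1 := by
  induction n with
  | zero => simp [stepProb]
  | succ n ih =>
    simp only [stepProb]
    rw [ENNReal.tsum_comm]
    simp only [ENNReal.tsum_mul_left, hrow, mul_one, ih]

/-- The expected number of visits before time `N` of a walk started at `x`. -/
noncomputable def truncatedGreen (p : X → X → ℝ≥0∞) (N : ℕ) (x y : X) : ℝ≥0∞ :=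
  ∑ n ∈ Finset.range N, stepProb p n x y

lemma tsum_truncatedGreen (hrow : ∀ x, ∑' y, p x y = 1) (N : ℕ) (x : X) :
    ∑' y, truncatedGreen p N x y = N := by
  simp only [truncatedGreen]
  rw [Summable.tsum_finsetSum (fun _ _ => ENNReal.summable)]
  simp [tsum_stepProb hrow]

lemma truncatedGreen_le (hrow : ∀ x, ∑' y, p x y = 1) (N : ℕ) (x y : X) :
    truncatedGreen p N x y ≤ N := by
  rw [← tsum_truncatedGreen hrow N x]
  exact ENNReal.le_tsum y

/-- One more step shifts the sum over times by one, and time `0` restores the missing term. -/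
lemma truncatedGreen_le_add (N : ℕ) (x y : X) :
    truncatedGreen p N x y ≤ stepProb p 0 x y + ∑' z, truncatedGreen p N x z * p z y := by
  have : ∑' z, truncatedGreen p N x z * p z y
      = ∑ n ∈ Finset.range N, stepProb p (n + 1) x y := by
    simp only [truncatedGreen, Finset.sum_mul, stepProb]
    rw [Summable.tsum_finsetSum (fun _ _ => ENNReal.summable)]
  rw [this, add_comm, ← Finset.sum_range_succ' (fun n => stepProb p n x y), truncatedGreen,
    Finset.sum_range_succ]
  exact le_self_add

/-- Pair the inequality `(1 - P)u ≤ δ_x` with `u`: this bounds `⟨u, (1 - P)u⟩` by `u x`. -/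
lemma dirichletEnergy_truncatedGreen_le (hsymm : ∀ x y, p x y = p y x)
    (hrow : ∀ x, ∑' y, p x y = 1) (N : ℕ) (x : X) :
    dirichletEnergy p (fun y => (truncatedGreen p N x y).toReal) ≤
      2 * truncatedGreen p N x x := by
  set u := truncatedGreen p N x with hu
  have huN : ∀ y, u y ≤ N := truncatedGreen_le hrow N x
  have hfin : ∀ y, u y ≠ ∞ := fun y => ne_top_of_le_ne_top (ENNReal.natCast_ne_top N) (huN y)
  have hE := dirichletEnergy_add_two_mul hsymm hrow hfin
  -- Finiteness is what permits cancelling this term at the end.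
  have hQ : ∑' y, u y * ∑' z, u z * p z y ≠ ∞ := by
    refine ne_top_of_le_ne_top (b := (N : ℝ≥0∞) * N) (by finiteness) ?_
    calc _ ≤ ∑' y, u y * ∑' z, (N : ℝ≥0∞) * p z y := by
          gcongr with y z
          exact huN z
      _ = N * N := by
          simp only [hsymm _ _, ENNReal.tsum_mul_left]
          simp only [hrow, ENNReal.tsum_mul_right, mul_one]
          rw [hu, tsum_truncatedGreen hrow]
  have hle : ∑' y, u y ^ 2 ≤ u x + ∑' y, u y * ∑' z, u z * p z y := by
    calc ∑' y, u y ^ 2 ≤ ∑' y, u y * (stepProb p 0 x y + ∑' z, u z * p z y) := by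
          simp only [sq]
          gcongr with y
          exact truncatedGreen_le_add N x y
      _ = _ := by
          simp only [mul_add, ENNReal.tsum_add]
          congr 1
          rw [tsum_eq_single x]
          · simp [stepProb]
          · intro y hy
            simp [stepProb, hy.symm]
  have : dirichletEnergy p (fun y => (u y).toReal) + 2 * ∑' y, u y * ∑' z, u z * p z y ≤
      2 * u x + 2 * ∑' y, u y * ∑' z, u z * p z y := by
    rw [hE, ← mul_add]
    gcongr
  exact (ENNReal.add_le_add_iff_right (by finiteness)).1 this

lemma sq_clamp_sub_clamp_le (a b : ℝ) :
    (max 0 (min 1 (2 * a - 1)) - max 0 (min 1 (2 * b - 1))) ^ 2 ≤ 4 * (a - b) ^ 2 := by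
  have h1 := sq_max_sub_max_le 0 (min 1 (2 * a - 1)) 0 (min 1 (2 * b - 1))
  have h2 := abs_min_sub_min_le_max 1 (2 * a - 1) 1 (2 * b - 1)
  rw [sub_self, abs_zero, max_eq_right (abs_nonneg _)] at h2
  have h3 := sq_le_sq.2 h2
  nlinarith

/-- Recurrence of a symmetric walk yields cutoff functions of small energy at a point. -/
lemma IsRecurrentWalk.exists_cutoff_point (hrec : IsRecurrentWalk p)
    (hsymm : ∀ x y, p x y = p y x) (hrow : ∀ x, ∑' y, p x y = 1) (x : X) {ε : ℝ}
    (hε : 0 < ε) :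
    ∃ a : X → ℝ, (∀ y, 0 ≤ a y) ∧ (∀ y, a y ≤ 1) ∧ a.support.Finite ∧ a x = 1 ∧
      dirichletEnergy p a ≤ ENNReal.ofReal ε := by
  obtain ⟨N, hN⟩ : ∃ N, ENNReal.ofReal (1 + 8 / ε) < truncatedGreen p N x x := by
    have := hrec x
    rw [ENNReal.tsum_eq_iSup_nat] at this
    exact lt_iSup_iff.1 (this ▸ ENNReal.ofReal_lt_top)
  set u : X → ℝ := fun y => (truncatedGreen p N x y).toReal with hu
  have hfin : ∀ y, truncatedGreen p N x y ≠ ∞ :=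
    fun y => ne_top_of_le_ne_top (ENNReal.natCast_ne_top N) (truncatedGreen_le hrow N x y)
  have hux : 1 + 8 / ε < u x := (ENNReal.ofReal_lt_iff_lt_toReal (by positivity) (hfin x)).1 hN
  have hu0 : 0 < u x := lt_trans (by positivity) hux
  have hsum : Summable u := ENNReal.summable_toReal (by
    rw [tsum_truncatedGreen hrow]; exact ENNReal.natCast_ne_top N)
  -- Clamping sends values of `u y / u x` up to `1/2` to `0`; as `u` is summable, only finitely many
  -- points survive. The energy is at most `4 / u x ^ 2 * (2 * u x) = 8 / u x`.
  refine ⟨fun y => max 0 (min 1 (2 * (u y / u x) - 1)), fun y => le_max_left _ _,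
    fun y => max_le zero_le_one (min_le_left _ _), ?_, ?_, ?_⟩
  · have h := hsum.tendsto_cofinite_zero.eventually (gt_mem_nhds (half_pos hu0))
    refine (Filter.eventually_cofinite.1 h).subset fun y hy hlt => hy ?_
    have : u y / u x < 1 / 2 := by
      rw [div_lt_iff₀ hu0]
      linarith
    exact max_eq_left ((min_le_right _ _).trans (by linarith))
  · simp only [div_self hu0.ne']
    norm_num
  · calc _ ≤ ENNReal.ofReal (4 / u x ^ 2) * dirichletEnergy p u := by
          refine dirichletEnergy_le_mul fun y z => (sq_clamp_sub_clamp_le _ _).trans (le_of_eq ?_)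
          field_simp
      _ ≤ ENNReal.ofReal (4 / u x ^ 2) * ENNReal.ofReal (2 * u x) := by
          gcongr
          refine (dirichletEnergy_truncatedGreen_le hsymm hrow N x).trans (le_of_eq ?_)
          rw [ENNReal.ofReal_mul zero_le_two, hu, ENNReal.ofReal_toReal (hfin x)]
          simp
      _ ≤ ENNReal.ofReal ε := by
          rw [← ENNReal.ofReal_mul (by positivity)]
          refine ENNReal.ofReal_le_ofReal ?_
          have : 4 / u x ^ 2 * (2 * u x) = 8 / u x := by
            field_simp
            norm_num
          rw [this, div_le_iff₀ hu0]
          have := (div_lt_iff₀ hε).1 (by linarith : 8 / ε < u x)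
          linarith

/-- Recurrence of a symmetric walk yields cutoff functions of small energy on finite sets. -/
lemma IsRecurrentWalk.exists_cutoff (hrec : IsRecurrentWalk p)
    (hsymm : ∀ x y, p x y = p y x) (hrow : ∀ x, ∑' y, p x y = 1) (F : Finset X) {ε : ℝ}
    (hε : 0 < ε) :
    ∃ a : X → ℝ, (∀ y, 0 ≤ a y) ∧ (∀ y, a y ≤ 1) ∧ a.support.Finite ∧ (∀ x ∈ F, a x = 1) ∧
      dirichletEnergy p a ≤ ENNReal.ofReal ε := by
  classical
  induction F using Finset.induction_on generalizing ε with
  | empty => exact ⟨fun _ => 0, by simp, by simp, by simp, by simp, by simp [dirichletEnergy]⟩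
  | insert x F _ ih =>
    obtain ⟨a, ha0, ha1, hafin, haF, haE⟩ := ih (half_pos hε)
    obtain ⟨b, hb0, hb1, hbfin, hbx, hbE⟩ :=
      hrec.exists_cutoff_point hsymm hrow x (half_pos hε)
    refine ⟨fun y => max (a y) (b y), fun y => (ha0 y).trans (le_max_left _ _),
      fun y => max_le (ha1 y) (hb1 y), (hafin.union hbfin).subset ?_, ?_, ?_⟩
    · exact Function.support_max a b
    · intro y hy
      rcases Finset.mem_insert.1 hy with rfl | hy
      · simp [hbx, ha1]
      · simp [haF y hy, hb1]
    · refine (dirichletEnergy_max_le a b).trans ((add_le_add haE hbE).trans ?_)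
      rw [← ENNReal.ofReal_add (half_pos hε).le (half_pos hε).le, add_halves]

end MarkovChain

/-! ### Symmetry of the driven walk. -/

section DrivenWalk

variable {G X : Type*} [Group G] [MulAction Gᵐᵒᵖ X] (μ : PMF G)

lemma tsum_drivenStep_left (y : X) : ∑' x, drivenStep μ x y = 1 := by
  rw [← μ.tsum_coe, ← (Equiv.sigmaFiberEquiv fun g : G => MulOpposite.op g • y).tsum_eq,
    ENNReal.tsum_sigma']
  refine tsum_congr fun x => ?_
  exact (Equiv.subtypeEquivRight fun g => eq_comm).tsum_eq
    (fun g : {g : G // MulOpposite.op g • y = x} => μ g)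

lemma tsum_drivenStep_right (x : X) : ∑' y, drivenStep μ x y = 1 := by
  rw [← μ.tsum_coe, ← (Equiv.sigmaFiberEquiv fun g : G => (MulOpposite.op g)⁻¹ • x).tsum_eq,
    ENNReal.tsum_sigma']
  refine tsum_congr fun y => ?_
  exact (Equiv.subtypeEquivRight fun g => inv_smul_eq_iff.symm).tsum_eq
    (fun g : {g : G // (MulOpposite.op g)⁻¹ • x = y} => μ g)

lemma le_drivenStep (g : G) (y : X) : μ g ≤ drivenStep μ (MulOpposite.op g • y) y :=
  ENNReal.le_tsum (f := fun h : {h : G // MulOpposite.op g • y = MulOpposite.op h • y} => μ h)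
    ⟨g, rfl⟩

variable {μ}

/-- A recurrent reversible walk driven by a non-degenerate measure is symmetric, since the
reversing function is constant on orbits. -/
lemma drivenStep_comm (hnd : IsNondegenerate μ)
    (hrev : IsReversibleWalk (drivenStep μ : X → X → ℝ≥0∞))
    (hrec : IsRecurrentWalk (drivenStep μ : X → X → ℝ≥0∞)) (x y : X) :
    drivenStep μ x y = drivenStep μ y x := by
  obtain ⟨s, hs0, hs⟩ := hrev
  have hharm (x : X) : ∑' y, (s y : ℝ≥0∞) * drivenStep μ y x = s x := by
    simp only [← hs x, ENNReal.tsum_mul_left, tsum_drivenStep_right, mul_one]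
  have hle : ∀ g : G, ∀ x : X, s x ≤ s (MulOpposite.op g • x) := by
    intro g
    have hg : g ∈ Subsemigroup.closure μ.support := by rw [hnd]; trivial
    induction hg using Subsemigroup.closure_induction with
    | mem g hg =>
      intro x
      have h := hrec.le_of_harmonic (tsum_drivenStep_left μ) (s := fun x => (s x : ℝ≥0∞))
        (fun x => ENNReal.coe_ne_top) hharm (x := x) (y := MulOpposite.op g • x)
        (fun h => (μ.mem_support_iff g).1 hg (le_zero_iff.1 (h ▸ le_drivenStep μ g x)))
      exact_mod_cast h
    | mul g h _ _ ihg ihh =>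
      intro x
      rw [MulOpposite.op_mul, mul_smul]
      exact (ihg x).trans (ihh _)
  have hconst (g : G) (x : X) : s (MulOpposite.op g • x) = s x := by
    refine le_antisymm ?_ (hle g x)
    -- The support generates the group as a semigroup, so monotonicity also holds along `g⁻¹`.
    simpa using hle g⁻¹ (MulOpposite.op g • x)
  have hsne (x : X) : (s x : ℝ≥0∞) ≠ 0 := by simpa using (hs0 x).ne'
  by_cases h : ∃ g : G, x = MulOpposite.op g • y
  · obtain ⟨g, rfl⟩ := h
    have := hs (MulOpposite.op g • y) y
    rw [hconst] at this
    exact (ENNReal.mul_right_inj (hsne y) ENNReal.coe_ne_top).1 this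
  · have h0 : drivenStep μ x y = 0 := by
      have : IsEmpty {g : G // x = MulOpposite.op g • y} := ⟨fun g => h ⟨g, g.2⟩⟩
      simp [drivenStep]
    have := hs x y
    rw [h0, mul_zero, eq_comm, mul_eq_zero] at this
    rw [h0, this.resolve_left (hsne y)]

lemma mul_tsum_sq_le_dirichletEnergy (g : G) (a : X → ℝ) :
    μ g * ∑' y, ENNReal.ofReal ((a (MulOpposite.op g • y) - a y) ^ 2) ≤
      dirichletEnergy (drivenStep μ) a := by
  rw [dirichletEnergy, ENNReal.tsum_comm, ← ENNReal.tsum_mul_left]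
  refine ENNReal.tsum_le_tsum fun y => le_trans ?_ (ENNReal.le_tsum (MulOpposite.op g • y))
  gcongr
  exact le_drivenStep μ g y

end DrivenWalk

/-! ### Random finite sets and their Hellinger-type continuity. -/

section Bernoulli

open Classical in
/-- The amplitude at `E` of the product over `x` of the unit vectors
`(cos (π / 2 * a x), sin (π / 2 * a x))`. -/
noncomputable def amplitude {X : Type*} (a : X → ℝ) (E : Finset X) : ℝ :=
  ∏ᶠ x, if x ∈ E then Real.sin (Real.pi / 2 * a x) else Real.cos (Real.pi / 2 * a x)

/-- The product of the measures giving weight `sin (π / 2 * a x) ^ 2` to containing `x`. -/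
noncomputable def bernoulliMass {X : Type*} (a : X → ℝ) (A : Set (Finset X)) : ℝ :=
  ∑' E, A.indicator (fun E => amplitude a E ^ 2) E

variable {X : Type*} {a b : X → ℝ} {S : Finset X}

lemma amplitude_eq_zero (ha : a.support ⊆ S) {E : Finset X} (hE : ¬ E ⊆ S) :
    amplitude a E = 0 := by
  classical
  obtain ⟨x, hxE, hxS⟩ := Finset.not_subset.1 hE
  have hx0 : ∀ y, y ∉ S → a y = 0 := fun y hy => by
    by_contra h
    exact hy (by exact_mod_cast ha h)
  rw [amplitude, finprod_eq_prod_of_mulSupport_subset (s := S ∪ E)]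
  · exact Finset.prod_eq_zero (Finset.mem_union_right _ hxE) (by simp [hxE, hx0 x hxS])
  · intro y hy
    by_contra h
    rw [Finset.mem_coe, Finset.mem_union, not_or] at h
    exact hy (by simp [h.2, hx0 y h.1])

lemma amplitude_eq_prod (ha : a.support ⊆ S) {E : Finset X} (hE : E ⊆ S) [DecidableEq X] :
    amplitude a E = (∏ x ∈ E, Real.sin (Real.pi / 2 * a x)) *
      ∏ x ∈ S \ E, Real.cos (Real.pi / 2 * a x) := by
  rw [amplitude, finprod_eq_prod_of_mulSupport_subset (s := S), ← Finset.prod_sdiff hE, mul_comm]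
  · congr 1
    · exact Finset.prod_congr rfl fun x hx => by simp [hx]
    · exact Finset.prod_congr rfl fun x hx => by simp [(Finset.mem_sdiff.1 hx).2]
  · intro y hy
    by_contra h
    have h0 : a y = 0 := by
      by_contra h'
      exact h (ha h')
    exact hy (by simp [show y ∉ E from fun h' => h (hE h'), h0])

lemma amplitude_eq_zero_of_eq_one (ha : a.support ⊆ S) {x : X} (hx : a x = 1) {E : Finset X}
    (hE : x ∉ E) : amplitude a E = 0 := by
  classical
  by_cases hES : E ⊆ S
  · rw [amplitude_eq_prod ha hES]
    have hxS : x ∈ S := ha (by simp [hx])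
    rw [Finset.prod_eq_zero (Finset.mem_sdiff.2 ⟨hxS, hE⟩) (by simp [hx]), mul_zero]
  · exact amplitude_eq_zero ha hES

/-- The inner product of product vectors factors over the points, and each factor is a cosine of a
difference of angles. -/
lemma sum_amplitude_mul (ha : a.support ⊆ S) (hb : b.support ⊆ S) :
    ∑ E ∈ S.powerset, amplitude a E * amplitude b E =
      ∏ x ∈ S, Real.cos (Real.pi / 2 * (a x - b x)) := by
  classical
  have (x : X) : Real.cos (Real.pi / 2 * (a x - b x)) =
      Real.sin (Real.pi / 2 * a x) * Real.sin (Real.pi / 2 * b x) +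
        Real.cos (Real.pi / 2 * a x) * Real.cos (Real.pi / 2 * b x) := by
    rw [mul_sub, Real.cos_sub]
    ring
  simp only [this]
  rw [Finset.prod_add]
  refine Finset.sum_congr rfl fun E hE => ?_
  rw [amplitude_eq_prod ha (Finset.mem_powerset.1 hE),
    amplitude_eq_prod hb (Finset.mem_powerset.1 hE), Finset.prod_mul_distrib,
    Finset.prod_mul_distrib]
  ring

lemma sum_sq_amplitude (ha : a.support ⊆ S) : ∑ E ∈ S.powerset, amplitude a E ^ 2 = 1 := by
  simp only [sq]
  simp [sum_amplitude_mul ha ha]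

open Classical in
lemma bernoulliMass_eq_sum (ha : a.support ⊆ S) (A : Set (Finset X)) :
    bernoulliMass a A = ∑ E ∈ S.powerset, if E ∈ A then amplitude a E ^ 2 else 0 := by
  rw [bernoulliMass, tsum_eq_sum (s := S.powerset)]
  · rfl
  · intro E hE
    simp [Set.indicator_apply, amplitude_eq_zero ha (fun h => hE (Finset.mem_powerset.2 h))]

lemma bernoulliMass_nonneg (a : X → ℝ) (A : Set (Finset X)) : 0 ≤ bernoulliMass a A :=
  tsum_nonneg fun _ => Set.indicator_nonneg (fun _ _ => sq_nonneg _) _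

lemma bernoulliMass_le_one (ha : a.support ⊆ S) (A : Set (Finset X)) : bernoulliMass a A ≤ 1 := by
  classical
  rw [bernoulliMass_eq_sum ha, ← sum_sq_amplitude ha]
  gcongr with E
  split_ifs
  · exact le_rfl
  · positivity

lemma bernoulliMass_eq_one (ha : a.support ⊆ S) {A : Set (Finset X)}
    (hA : ∀ E, E ∉ A → amplitude a E = 0) : bernoulliMass a A = 1 := by
  classical
  rw [bernoulliMass_eq_sum ha, ← sum_sq_amplitude ha]
  refine Finset.sum_congr rfl fun E _ => ?_
  split_ifs with h
  · rfl
  · simp [hA E h]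

lemma bernoulliMass_union (ha : a.support ⊆ S) {A B : Set (Finset X)} (h : Disjoint A B) :
    bernoulliMass a (A ∪ B) = bernoulliMass a A + bernoulliMass a B := by
  classical
  simp only [bernoulliMass_eq_sum ha, ← Finset.sum_add_distrib]
  refine Finset.sum_congr rfl fun E _ => ?_
  by_cases hA : E ∈ A
  · simp [hA, Set.disjoint_left.1 h hA]
  · simp [hA]

lemma one_sub_sum_le_prod_one_sub {e : X → ℝ} (S : Finset X) (h0 : ∀ x ∈ S, 0 ≤ e x)
    (h1 : ∀ x ∈ S, e x ≤ 1) : 1 - ∑ x ∈ S, e x ≤ ∏ x ∈ S, (1 - e x) := by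
  classical
  induction S using Finset.induction_on with
  | empty => simp
  | insert x S hx ih =>
    rw [Finset.sum_insert hx, Finset.prod_insert hx]
    have hS := ih (fun y hy => h0 y (Finset.mem_insert_of_mem hy))
      (fun y hy => h1 y (Finset.mem_insert_of_mem hy))
    have : 0 ≤ ∑ y ∈ S, e y :=
      Finset.sum_nonneg fun y hy => h0 y (Finset.mem_insert_of_mem hy)
    nlinarith [h0 x (Finset.mem_insert_self x S), h1 x (Finset.mem_insert_self x S)]

lemma one_sub_le_sum_amplitude_mul (ha : a.support ⊆ S) (hb : b.support ⊆ S)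
    (ha0 : ∀ x, 0 ≤ a x) (ha1 : ∀ x, a x ≤ 1) (hb0 : ∀ x, 0 ≤ b x) (hb1 : ∀ x, b x ≤ 1) :
    1 - 2 * ∑ x ∈ S, (a x - b x) ^ 2 ≤ ∑ E ∈ S.powerset, amplitude a E * amplitude b E := by
  have hcos (x : X) : 0 ≤ Real.cos (Real.pi / 2 * (a x - b x)) := by
    refine Real.cos_nonneg_of_neg_pi_div_two_le_of_le ?_ ?_ <;>
    nlinarith [Real.pi_pos, ha0 x, ha1 x, hb0 x, hb1 x]
  have h := one_sub_sum_le_prod_one_sub (e := fun x => 1 - Real.cos (Real.pi / 2 * (a x - b x))) S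
    (fun x _ => sub_nonneg.2 (Real.cos_le_one _)) (fun x _ => by linarith [hcos x])
  simp only [sub_sub_cancel] at h
  rw [sum_amplitude_mul ha hb]
  refine le_trans ?_ h
  rw [Finset.mul_sum]
  gcongr with x
  -- The constant `2` comes from `π ^ 2 / 8 ≤ 2`.
  have h1 := Real.one_sub_sq_div_two_le_cos (x := Real.pi / 2 * (a x - b x))
  have hpi : Real.pi ^ 2 ≤ 16 := by nlinarith [Real.pi_pos, Real.pi_le_four]
  nlinarith [sq_nonneg (a x - b x)]

/-- Factor `α² - β² = (α - β)(α + β)` and apply Cauchy–Schwarz: with inner product `c`, the bound is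
`4(1 - c²) ≤ 8(1 - c)`, and `1 - c` is at most twice the squared distance. -/
lemma sq_bernoulliMass_sub_le (ha : a.support ⊆ S) (hb : b.support ⊆ S)
    (ha0 : ∀ x, 0 ≤ a x) (ha1 : ∀ x, a x ≤ 1) (hb0 : ∀ x, 0 ≤ b x) (hb1 : ∀ x, b x ≤ 1)
    (A : Set (Finset X)) :
    (bernoulliMass a A - bernoulliMass b A) ^ 2 ≤ 16 * ∑ x ∈ S, (a x - b x) ^ 2 := by
  classical
  have hc := one_sub_le_sum_amplitude_mul ha hb ha0 ha1 hb0 hb1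
  have haa := sum_sq_amplitude ha
  have hbb := sum_sq_amplitude hb
  set c := ∑ E ∈ S.powerset, amplitude a E * amplitude b E
  have hm : ∑ E ∈ S.powerset, (amplitude a E - amplitude b E) ^ 2 = 2 - 2 * c := by
    simp only [sub_sq, Finset.sum_add_distrib, Finset.sum_sub_distrib, mul_assoc, ← Finset.mul_sum]
    linarith
  have hp : ∑ E ∈ S.powerset, (amplitude a E + amplitude b E) ^ 2 = 2 + 2 * c := by
    simp only [add_sq, Finset.sum_add_distrib, mul_assoc, ← Finset.mul_sum]
    linarith
  have hm0 : 0 ≤ 2 - 2 * c := hm ▸ Finset.sum_nonneg fun _ _ => sq_nonneg _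
  calc (bernoulliMass a A - bernoulliMass b A) ^ 2
      = (∑ E ∈ S.powerset, (amplitude a E - amplitude b E) *
          (if E ∈ A then amplitude a E + amplitude b E else 0)) ^ 2 := by
        rw [bernoulliMass_eq_sum ha, bernoulliMass_eq_sum hb, ← Finset.sum_sub_distrib]
        congr 1
        refine Finset.sum_congr rfl fun E _ => ?_
        split_ifs <;> ring
    _ ≤ (∑ E ∈ S.powerset, (amplitude a E - amplitude b E) ^ 2) *
        ∑ E ∈ S.powerset, (if E ∈ A then amplitude a E + amplitude b E else 0) ^ 2 :=
        Finset.sum_mul_sq_le_sq_mul_sq _ _ _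
    _ ≤ (2 - 2 * c) * (2 + 2 * c) := by
        rw [← hm, ← hp]
        refine mul_le_mul_of_nonneg_left (Finset.sum_le_sum fun E _ => ?_) (hm ▸ hm0)
        split_ifs
        · exact le_rfl
        · rw [zero_pow two_ne_zero]
          positivity
    _ ≤ 16 * ∑ x ∈ S, (a x - b x) ^ 2 := by nlinarith

end Bernoulli

/-! ### Almost invariance under translation. -/

section Translate

variable {G X : Type*} [Group G] [MulAction Gᵐᵒᵖ X]

lemma mem_translateFinset {E : Finset X} {g : G} {x : X} :
    MulOpposite.op g • x ∈ translateFinset E g ↔ x ∈ E := by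
  simp [translateFinset]

lemma translateFinset_injective (g : G) :
    Function.Injective fun E : Finset X => translateFinset E g :=
  Finset.map_injective _

lemma translateFinset_translateFinset (E : Finset X) (g h : G) :
    translateFinset (translateFinset E g) h = translateFinset E (g * h) := by
  ext x
  simp [translateFinset, mul_smul]

lemma translateFinset_inv (E : Finset X) (g : G) :
    translateFinset (translateFinset E g⁻¹) g = E := by
  rw [translateFinset_translateFinset, inv_mul_cancel]
  ext x
  simp [translateFinset]

lemma amplitude_translateFinset (a : X → ℝ) (E : Finset X) (g : G) :
    amplitude a (translateFinset E g) = amplitude (fun x => a (MulOpposite.op g • x)) E := by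
  classical
  rw [amplitude, amplitude,
    ← finprod_comp_equiv (MulAction.toPerm (MulOpposite.op g) : Equiv.Perm X)]
  simp only [MulAction.toPerm_apply, mem_translateFinset]

lemma bernoulliMass_image_translateFinset (a : X → ℝ) (A : Set (Finset X)) (g : G) :
    bernoulliMass a ((fun E => translateFinset E g) '' A) =
      bernoulliMass (fun x => a (MulOpposite.op g • x)) A := by
  have hbij : Function.Bijective fun E : Finset X => translateFinset E g :=
    ⟨translateFinset_injective g, fun E => ⟨_, translateFinset_inv E g⟩⟩
  rw [bernoulliMass, bernoulliMass, ← (Equiv.ofBijective _ hbij).tsum_eq]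
  refine tsum_congr fun E => ?_
  classical
  simp only [Equiv.ofBijective_apply, Set.indicator_apply, amplitude_translateFinset,
    (translateFinset_injective g).mem_set_image]

lemma sq_bernoulliMass_translate_sub_le {μ : PMF G} {g : G} (hg : g ∈ μ.support) {a : X → ℝ}
    (ha0 : ∀ x, 0 ≤ a x) (ha1 : ∀ x, a x ≤ 1) (hfin : a.support.Finite) {ε : ℝ} (hε : 0 ≤ ε)
    (hE : dirichletEnergy (drivenStep μ) a ≤ ENNReal.ofReal ε) (A : Set (Finset X)) :
    (bernoulliMass a ((fun E => translateFinset E g) '' A) - bernoulliMass a A) ^ 2 ≤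
      16 * ε / (μ g).toReal := by
  classical
  have hfin' : (fun x => a (MulOpposite.op g • x)).support.Finite :=
    hfin.preimage (MulAction.injective (MulOpposite.op g)).injOn
  set S := hfin.toFinset ∪ hfin'.toFinset with hS
  have hμ0 : μ g ≠ 0 := (μ.mem_support_iff g).1 hg
  have hμ : 0 < (μ g).toReal := ENNReal.toReal_pos hμ0 (μ.apply_ne_top g)
  rw [bernoulliMass_image_translateFinset]
  refine (sq_bernoulliMass_sub_le (S := S) (fun x hx => ?_) (fun x hx => ?_) (fun x => ha0 _)
    (fun x => ha1 _) ha0 ha1 A).trans ?_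
  · exact Finset.mem_union_right _ (hfin'.mem_toFinset.2 hx)
  · exact Finset.mem_union_left _ (hfin.mem_toFinset.2 hx)
  · rw [mul_div_assoc, mul_le_mul_iff_right₀ (by norm_num), le_div_iff₀ hμ, mul_comm,
      ← ENNReal.ofReal_le_ofReal_iff hε, ENNReal.ofReal_mul hμ.le,
      ENNReal.ofReal_toReal (μ.apply_ne_top g),
      ENNReal.ofReal_sum_of_nonneg fun _ _ => sq_nonneg _]
    refine le_trans ?_ ((mul_tsum_sq_le_dirichletEnergy g a).trans hE)
    gcongr
    exact ENNReal.sum_le_tsum S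

end Translate

/-! ### Passage to the limit. -/

open Filter Topology in
/-- Means can be obtained as ultrafilter limits. -/
lemma exists_mean_tendsto {ι Y : Type*} (U : Ultrafilter ι) (ν : ι → Mean Y) :
    ∃ m : Mean Y, ∀ A, Tendsto (fun i => (ν i).toFun A) U (𝓝 (m.toFun A)) := by
  have h (A : Set Y) : ∃ t ∈ Set.Icc (0 : ℝ) 1, Tendsto (fun i => (ν i).toFun A) U (𝓝 t) :=
    isCompact_Icc.ultrafilter_le_nhds (U.map fun i => (ν i).toFun A)
      (le_principal_iff.2 (mem_map.2 (univ_mem' fun i => ⟨(ν i).nonneg A, (ν i).le_one A⟩)))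
  choose t ht01 ht using h
  refine ⟨⟨t, fun A => (ht01 A).1, fun A => (ht01 A).2, ?_, fun A B hAB => ?_⟩, ht⟩
  · refine tendsto_nhds_unique (ht _) ?_
    simp only [(ν _).map_univ]
    exact tendsto_const_nhds
  · refine tendsto_nhds_unique (ht _) ?_
    simp only [(ν _).map_union A B hAB]
    exact (ht A).add (ht B)

/-- The mean on finite sets defined by a finitely supported function. -/
noncomputable def bernoulliMean {X : Type*} (a : X → ℝ) (ha : a.support.Finite) :
    Mean (Finset X) where
  toFun := bernoulliMass a
  nonneg := bernoulliMass_nonneg a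
  le_one := bernoulliMass_le_one ha.coe_toFinset.ge
  map_univ := bernoulliMass_eq_one ha.coe_toFinset.ge (by simp)
  map_union _ _ := bernoulliMass_union ha.coe_toFinset.ge

open Filter Topology in
theorem mainTheorem9 {G X : Type*} [Group G] [MulAction Gᵐᵒᵖ X] (μ : PMF G)
    (hnd : IsNondegenerate μ)
    (hrev : IsReversibleWalk (drivenStep μ : X → X → ℝ≥0∞))
    (hrec : IsRecurrentWalk (drivenStep μ : X → X → ℝ≥0∞)) :
    IsExtensivelyAmenable G X := by
  classical
  -- The index `(F, n)` asks for the value `1` on `F` and energy at most `1 / (n + 1)`.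
  have hcut (i : Finset X × ℕ) := hrec.exists_cutoff (drivenStep_comm hnd hrev hrec)
    (tsum_drivenStep_right μ) i.1 (Nat.one_div_pos_of_nat (α := ℝ) (n := i.2))
  choose a ha0 ha1 hfin haF haE using hcut
  obtain ⟨m, hm⟩ := exists_mean_tendsto (Ultrafilter.of (atTop : Filter (Finset X × ℕ)))
    fun i => bernoulliMean (a i) (hfin i)
  have hU := Ultrafilter.of_le (atTop : Filter (Finset X × ℕ))
  refine ⟨m, fun g => ?_, fun x => ?_⟩
  · have hg : g ∈ Subsemigroup.closure μ.support := by rw [hnd]; trivial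
    -- Energy controls only `g` in the support; exact invariance of the limit then passes to
    -- products.
    induction hg using Subsemigroup.closure_induction with
    | mem g hg =>
      intro A
      have hlim := ((hm ((fun E => translateFinset E g) '' A)).sub (hm A)).pow 2
      have h0 : Tendsto (fun i : Finset X × ℕ => 16 * (1 / ((i.2 : ℝ) + 1)) / (μ g).toReal)
          atTop (𝓝 (16 * 0 / (μ g).toReal)) := by
        rw [← prod_atTop_atTop_eq]
        exact ((tendsto_one_div_add_atTop_nhds_zero_nat.comp tendsto_snd).const_mul 16).div_const _
      have hle := le_of_tendsto_of_tendsto hlim (h0.mono_left hU) (Eventually.of_forall fun i =>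
        sq_bernoulliMass_translate_sub_le hg (ha0 i) (ha1 i) (hfin i) (by positivity) (haE i) A)
      rw [mul_zero, zero_div] at hle
      exact sub_eq_zero.1 (pow_eq_zero_iff two_ne_zero |>.1 (le_antisymm hle (sq_nonneg _)))
    | mul g h _ _ ihg ihh =>
      intro A
      rw [← ihg A, ← ihh ((fun E => translateFinset E g) '' A), Set.image_image]
      simp only [translateFinset_translateFinset]
  · refine tendsto_nhds_unique (hm _) (tendsto_const_nhds.congr' ?_)
    have hev : ∀ᶠ i : Finset X × ℕ in atTop, x ∈ i.1 :=
      (eventually_ge_atTop (({x} : Finset X), 0)).mono fun i hi => hi.1 (Finset.mem_singleton_self x)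
    filter_upwards [hU hev] with i hi
    exact (bernoulliMass_eq_one (hfin i).coe_toFinset.ge fun E hE =>
      amplitude_eq_zero_of_eq_one (hfin i).coe_toFinset.ge (haF i x hi) hE).symm
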